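/- Let $\alpha$ be an irrational real number with continued fraction expansion $\alpha=[a_0;a_1,a_2,\dots]$ whose partial quotients are bounded in average, i.e. there is a constant $B$ with $\frac1m\sum_{i=1}^m a_i\le B$ for all $m\ge 1$. For each $n\ge 1$ let $\beta_\alpha=\beta_{\alpha,n}$ be the permutation of $\{1,\dots,n\}$ determined by $\beta_\alpha(s)<\beta_\alpha(t)$ if and only if $\{\alpha s\}<\{\alpha t\}$, where $\{x\}$ denotes the fractional part of $x$; regard it as a permutation of $\mathbb{Z}_n=\mathbb{Z}/n\mathbb{Z}$ by identifying $\{1,\dots,n\}$ with $\mathbb{Z}_n$ via reduction modulo $n$. For a permutation $\sigma$ of $\mathbb{Z}_n$ define its discrepancy $$D(\sigma)=\max_{I,J}\left|\,|\sigma(I)\cap J|-\frac{|I|\,|J|}{n}\right|,$$ where $I$ and $J$ range over all intervals of $\mathbb{Z}_n$, that is, all images in $\mathbb{Z}_n$ of intervals of $\mathbb{Z}$. Then $\beta_\alpha$ is maximally quasirandom, that is, $D(\beta_\alpha)\ll\log n$: there exist constants $C$ and $N$ (which may depend on $\alpha$) such that $D(\beta_{\alpha,n})\le C\log n$ for all $n\ge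 N$. -/

import Mathlib

noncomputable section

/-- The `i`-th partial quotient `aᵢ` (`i ≥ 1`) of the regular continued fraction
`α = [a₀; a₁, a₂, …]`. The value `0` at `i = 0`, or where a finite expansion has ended, is a
convention; for irrational `α` the expansion does not end. -/
def partialQuotient (α : ℝ) : ℕ → ℝ
  | 0 => 0
  | i + 1 => ((GenContFract.of α).partDens.get? i).getD 0

/-- The partial quotients of `α` are bounded in average: the means
`(a₁ + ⋯ + aₘ) / m`, `m ≥ 1`, are bounded. -/
def PartialQuotientsBoundedInAverage (α : ℝ) : Prop :=
  ∃ B : ℝ, ∀ m : ℕ, 1 ≤ m → (∑ i ∈ Finset.Icc 1 m, partialQuotient α i) / m ≤ B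

/-- Intervals of `ℤ/nℤ`: projections of intervals of `ℤ` (they may wrap around). -/
def IsCyclicInterval {n : ℕ} (I : Finset (ZMod n)) : Prop :=
  ∃ a b : ℤ, (I : Set (ZMod n)) = (fun z : ℤ => (z : ZMod n)) '' Set.Icc a b

/-- The discrepancy `D_T(S) = | |S ∩ T| - |S| |T| / n |` of `S` in `T`. -/
def setDiscrepancy {n : ℕ} (T S : Finset (ZMod n)) : ℝ :=
  |((S ∩ T).card : ℝ) - (S.card : ℝ) * (T.card : ℝ) / (n : ℝ)|

/-- The values `D_J(σ(I))`, where `I` and `J` vary over all intervals of `ℤ/nℤ`. -/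
def discrepancyValues {n : ℕ} (σ : Equiv.Perm (ZMod n)) : Set ℝ :=
  {d | ∃ I J : Finset (ZMod n), IsCyclicInterval I ∧ IsCyclicInterval J ∧
    d = setDiscrepancy J (I.map σ.toEmbedding)}

/-- The discrepancy `D(σ) = max_{I,J} D_J(σ(I))` of a permutation of `ℤ/nℤ`. -/
def permDiscrepancy {n : ℕ} (σ : Equiv.Perm (ZMod n)) : ℝ :=
  sSup (discrepancyValues σ)

/-- The supremum in `permDiscrepancy` is a maximum. -/
theorem isGreatest_permDiscrepancy {n : ℕ} [NeZero n] (σ : Equiv.Perm (ZMod n)) :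
    IsGreatest (discrepancyValues σ) (permDiscrepancy σ) := by
  have hfin : (discrepancyValues σ).Finite := by
    refine (Set.finite_range (fun p : Finset (ZMod n) × Finset (ZMod n) =>
      setDiscrepancy p.2 (p.1.map σ.toEmbedding))).subset ?_
    rintro d ⟨I, J, _, _, rfl⟩
    exact ⟨(I, J), rfl⟩
  have hne : (discrepancyValues σ).Nonempty :=
    ⟨_, ∅, ∅, ⟨1, 0, by simp⟩, ⟨1, 0, by simp⟩, rfl⟩
  exact ⟨hne.csSup_mem hfin, fun d hd => le_csSup hfin.bddAbove hd⟩

/-- The number of `s ∈ {1, …, n}` with `{α s} ≤ {α t}`. -/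
def sosRank (α : ℝ) (n t : ℕ) : ℕ :=
  ((Finset.Icc 1 n).filter fun s : ℕ => Int.fract (α * s) ≤ Int.fract (α * t)).card

theorem sosRank_mem (α : ℝ) (n : ℕ) (t : Finset.Icc 1 n) :
    sosRank α n t ∈ Finset.Icc 1 n := by
  rw [Finset.mem_Icc]
  constructor
  · exact Finset.card_pos.mpr ⟨t, Finset.mem_filter.mpr ⟨t.2, le_rfl⟩⟩
  · exact (Finset.card_filter_le _ _).trans (by simp)

theorem sosRank_lt_iff (α : ℝ) (n : ℕ) (s t : Finset.Icc 1 n) :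
    sosRank α n s < sosRank α n t ↔ Int.fract (α * (s : ℕ)) < Int.fract (α * (t : ℕ)) := by
  constructor
  · intro h
    by_contra! hle
    refine absurd h (not_lt.mpr (Finset.card_le_card fun x hx => ?_))
    rw [Finset.mem_filter] at hx ⊢
    exact ⟨hx.1, hx.2.trans hle⟩
  · intro h
    refine Finset.card_lt_card ((Finset.ssubset_iff_of_subset fun x hx => ?_).mpr
      ⟨t, Finset.mem_filter.mpr ⟨t.2, le_rfl⟩, fun hx => ?_⟩)
    · rw [Finset.mem_filter] at hx ⊢
      exact ⟨hx.1, hx.2.trans h.le⟩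
    · exact absurd (Finset.mem_filter.mp hx).2 (not_le.mpr h)

theorem fract_mul_injective {α : ℝ} (hα : Irrational α) {s t : ℕ}
    (h : Int.fract (α * s) = Int.fract (α * t)) : s = t := by
  by_contra hne
  obtain ⟨z, hz⟩ := Int.fract_eq_fract.mp h
  have hd : ((s : ℤ) - (t : ℤ)) ≠ 0 := by omega
  refine (hα.mul_intCast hd).ne_int z ?_
  push_cast
  linarith

/-- The Sós permutation `β_α` of `[n] = {1, …, n}`, `α` irrational: `β_α(t)` is the number of
`s ∈ [n]` with `{α s} ≤ {α t}`. -/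
def sosPerm (α : ℝ) (hα : Irrational α) (n : ℕ) : Equiv.Perm (Finset.Icc 1 n) :=
  Equiv.ofBijective (fun t => ⟨sosRank α n t, sosRank_mem α n t⟩) <| by
    refine Finite.injective_iff_bijective.mp fun s t h => ?_
    have h' : sosRank α n s = sosRank α n t := congrArg Subtype.val h
    refine Subtype.ext (fract_mul_injective hα (le_antisymm ?_ ?_))
    · exact not_lt.mp fun hlt => absurd ((sosRank_lt_iff α n t s).mpr hlt) (by omega)
    · exact not_lt.mp fun hlt => absurd ((sosRank_lt_iff α n s t).mpr hlt) (by omega)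

/-- The defining property of `β_α`. -/
theorem sosPerm_lt_iff (α : ℝ) (hα : Irrational α) (n : ℕ) (s t : Finset.Icc 1 n) :
    sosPerm α hα n s < sosPerm α hα n t ↔
      Int.fract (α * (s : ℕ)) < Int.fract (α * (t : ℕ)) :=
  sosRank_lt_iff α n s t

/-- The identification of `[n] = {1, …, n}` with `ℤ/nℤ` by reduction modulo `n`. -/
def residueEquiv (n : ℕ) [NeZero n] : Finset.Icc 1 n ≃ ZMod n :=
  Equiv.ofBijective (fun t => ((t : ℕ) : ZMod n)) <| by
    refine (Fintype.bijective_iff_injective_and_card _).mpr ⟨fun s t h => ?_, by simp [ZMod.card]⟩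
    have hs := Finset.mem_Icc.mp s.2
    have ht := Finset.mem_Icc.mp t.2
    have hdvd := (Nat.modEq_iff_dvd.mp ((ZMod.natCast_eq_natCast_iff _ _ _).mp h))
    have h0 : ((t : ℕ) : ℤ) - ((s : ℕ) : ℤ) = 0 := by
      refine Int.eq_zero_of_abs_lt_dvd hdvd ?_
      rw [abs_lt]
      constructor <;> omega
    exact Subtype.ext (by omega)

/-- The Sós permutation `β_α` regarded as a permutation of `ℤ/nℤ`. -/
def sosPermZMod (α : ℝ) (hα : Irrational α) (n : ℕ) [NeZero n] : Equiv.Perm (ZMod n) :=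
  (residueEquiv n).permCongr (sosPerm α hα n)

end

/-! Let `p / q` be a convergent of `α`. Over `q` consecutive steps the rotation by `α` stays within
`1 / q` of the rotation by `p / q`, which visits each of `q` equal arcs once; so such a block has
bounded discrepancy, whatever its starting point. Greedy (Ostrowski) division cuts any `N` below the
`m`-th denominator into blocks whose lengths are denominators, with at most `aᵢ + 1` of each, so the
discrepancy is at most `3 ∑ (aᵢ + 1)`. Denominators grow exponentially, so `m = O(log n)` suffices
for `N ≤ n`, and the bounded average makes the sum `O(log n)`.

For the permutation, the condition `β(t) ≤ B` means `{α t} ≤ x` for a threshold `x`, so pairs of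
initial segments are orbit counts. Cyclic intervals follow by inclusion and exclusion. -/

open Finset

/-! ### Orbit counts and blocks of convergent length -/

/-- The number of `j < N` with `{c + α j} ≤ x`. -/
noncomputable def rotationCount (α c : ℝ) (N : ℕ) (x : ℝ) : ℕ :=
  #{j ∈ range N | Int.fract (c + α * (j : ℕ)) ≤ x}

theorem rotationCount_zero (α c x : ℝ) : rotationCount α c 0 x = 0 := by
  simp [rotationCount]

theorem rotationCount_add (α c : ℝ) (M N : ℕ) (x : ℝ) :
    rotationCount α c (M + N) x = rotationCount α c M x + rotationCount α (c + α * M) N x := by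
  simp only [rotationCount, card_filter]
  rw [sum_range_add]
  congr 1
  refine sum_congr rfl fun j _ => ?_
  push_cast
  rw [mul_add, add_assoc]

/-- Over a full period of a rational approximation `p / q` of `α`, the cell of the orbit in the
partition of the circle into `q` equal arcs is that of the rational rotation, up to one step. -/
theorem card_filter_cell_le {α : ℝ} (c : ℝ) {p : ℤ} {q : ℕ} (hq : 0 < q)
    (hpq : IsCoprime p (q : ℤ)) (happ : |q * α - p| ≤ 1 / q) {a b : ℤ} (hab : a ≤ b)
    (P : ℕ → Prop) [DecidablePred P]
    (hP : ∀ j < q, P j → ⌊q * Int.fract (c + α * (j : ℕ))⌋ ∈ Ico a b) :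
    (#{j ∈ range q | P j} : ℤ) ≤ b - a + 2 := by
  set K : ℤ := ⌊(q : ℝ) * c⌋
  have hq' : (0 : ℝ) < q := by exact_mod_cast hq
  -- `r j` is the cell under the rational rotation, congruent to `K + j p` modulo `q`. Since `j <
  -- q`, the drift `j (q α - p)` is below one cell width.
  set r : ℕ → ℤ := fun j => K + j * p - q * ⌊c + α * j⌋
  have hcell : ∀ j < q, |⌊q * Int.fract (c + α * (j : ℕ))⌋ - r j| ≤ 1 := by
    intro j hj
    have hj' : (j : ℝ) + 1 ≤ q := by exact_mod_cast hj
    have hsmall : |(j : ℝ) * (q * α - p)| < 1 := by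
      rw [abs_mul, abs_of_nonneg (Nat.cast_nonneg j)]
      calc (j : ℝ) * |q * α - p| ≤ j * (1 / q) := by gcongr
        _ < 1 := by rw [mul_one_div, div_lt_one hq']; linarith
    rw [abs_lt] at hsmall
    have h1 : (q : ℝ) * Int.fract (c + α * j) =
        (q * c + j * (q * α - p)) + ((j * p - q * ⌊c + α * j⌋ : ℤ) : ℝ) := by
      rw [← Int.self_sub_floor]
      push_cast
      ring
    rw [h1, Int.floor_add_intCast]
    have h2 : ⌊(q : ℝ) * c + j * (q * α - p)⌋ ≤ K + 1 := by
      rw [← Int.lt_add_one_iff, Int.floor_lt]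
      have := Int.lt_floor_add_one ((q : ℝ) * c)
      push_cast
      linarith
    have h3 : K - 1 ≤ ⌊(q : ℝ) * c + j * (q * α - p)⌋ := by
      rw [Int.le_floor]
      have := Int.floor_le ((q : ℝ) * c)
      push_cast
      linarith
    rw [abs_le]
    constructor <;> linarith
  -- Coprimality makes `r` injective on `j < q`; the error of one cell enlarges the target by one at
  -- each end.
  have hcard : #{j ∈ range q | P j} ≤ #(Ico (a - 1) (b + 1)) := by
    refine card_le_card_of_injOn r (fun j hj => ?_) (fun i hi j hj hij => ?_)
    · rw [mem_coe, mem_filter, mem_range] at hj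
      have h1 := mem_Ico.mp (hP j hj.1 hj.2)
      have h2 := abs_le.mp (hcell j hj.1)
      rw [mem_coe, mem_Ico]
      omega
    · rw [mem_coe, mem_filter, mem_range] at hi hj
      have hdvd : (q : ℤ) ∣ ((i : ℤ) - j) * p :=
        ⟨⌊c + α * i⌋ - ⌊c + α * j⌋, by simp only [r] at hij; linarith⟩
      have h0 := Int.eq_zero_of_abs_lt_dvd (hpq.symm.dvd_of_dvd_mul_right hdvd)
        (by rw [abs_lt]; omega)
      omega
  rw [Int.card_Ico] at hcard
  omega

/-- The discrepancy of a block of length `q`, where `p / q` approximates `α`, is bounded. -/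
theorem abs_rotationCount_sub_le {α : ℝ} (c : ℝ) {p : ℤ} {q : ℕ} (hq : 0 < q)
    (hpq : IsCoprime p (q : ℤ)) (happ : |q * α - p| ≤ 1 / q) {x : ℝ} (hx0 : 0 ≤ x)
    (hx1 : x ≤ 1) : |(rotationCount α c q x : ℝ) - q * x| ≤ 3 := by
  have hq' : (0 : ℝ) < q := by exact_mod_cast hq
  have hk0 : 0 ≤ ⌊(q : ℝ) * x⌋ := Int.floor_nonneg.mpr (by positivity)
  have hkq : ⌊(q : ℝ) * x⌋ ≤ q := by
    rw [Int.floor_le_iff]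
    push_cast
    nlinarith
  have hz0 : ∀ y : ℝ, 0 ≤ ⌊(q : ℝ) * Int.fract y⌋ := fun y =>
    Int.floor_nonneg.mpr (mul_nonneg hq'.le (Int.fract_nonneg y))
  have hzq : ∀ y : ℝ, ⌊(q : ℝ) * Int.fract y⌋ < q := fun y => by
    rw [Int.floor_lt]
    push_cast
    nlinarith [Int.fract_lt_one y]
  have hupper := card_filter_cell_le c hq hpq happ (a := 0) (b := ⌊(q : ℝ) * x⌋ + 1) (by omega)
    (fun j => Int.fract (c + α * (j : ℕ)) ≤ x) (fun j _ hj => by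
      rw [mem_Ico, Int.lt_add_one_iff]
      exact ⟨hz0 _, Int.floor_le_floor (by gcongr)⟩)
  -- The lower bound comes from an upper bound on the complement; the cell containing `x` is allowed
  -- in both counts.
  have hlower := card_filter_cell_le c hq hpq happ (a := ⌊(q : ℝ) * x⌋) (b := q) hkq
    (fun j => ¬ Int.fract (c + α * (j : ℕ)) ≤ x) (fun j _ hj => by
      rw [mem_Ico]
      exact ⟨Int.floor_le_floor (by gcongr; exact (not_le.mp hj).le), hzq _⟩)
  have hsum := card_filter_add_card_filter_not (s := range q)
    (fun j => Int.fract (c + α * (j : ℕ)) ≤ x)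
  rw [card_range] at hsum
  change (rotationCount α c q x : ℤ) ≤ _ at hupper
  change rotationCount α c q x + _ = q at hsum
  have h1 : (rotationCount α c q x : ℤ) ≤ ⌊(q : ℝ) * x⌋ + 3 := by omega
  have h2 : ⌊(q : ℝ) * x⌋ - 2 ≤ (rotationCount α c q x : ℤ) := by omega
  have h1' : (rotationCount α c q x : ℝ) ≤ ⌊(q : ℝ) * x⌋ + 3 := by exact_mod_cast h1
  have h2' : (⌊(q : ℝ) * x⌋ : ℝ) - 2 ≤ rotationCount α c q x := by exact_mod_cast h2
  have := Int.floor_le ((q : ℝ) * x)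
  have := Int.lt_floor_add_one ((q : ℝ) * x)
  rw [abs_le]
  constructor <;> linarith

theorem abs_rotationCount_add_sub_le (α c : ℝ) (M N : ℕ) (x : ℝ) :
    |(rotationCount α c (M + N) x : ℝ) - (M + N : ℕ) * x| ≤
      |(rotationCount α c M x : ℝ) - M * x| +
        |(rotationCount α (c + α * M) N x : ℝ) - N * x| := by
  rw [rotationCount_add]
  refine le_trans (le_of_eq ?_) (abs_add_le _ _)
  push_cast
  ring_nf

theorem abs_rotationCount_mul_sub_le {α x K : ℝ} {q : ℕ}
    (h : ∀ c, |(rotationCount α c q x : ℝ) - q * x| ≤ K) (b : ℕ) (c : ℝ) :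
    |(rotationCount α c (b * q) x : ℝ) - (b * q : ℕ) * x| ≤ b * K := by
  induction b with
  | zero => simp [rotationCount_zero]
  | succ b ih =>
    rw [add_mul, one_mul]
    refine (abs_rotationCount_add_sub_le ..).trans ?_
    push_cast
    have := h (c + α * (b * q : ℕ))
    push_cast at ih this
    linarith

/-! ### Convergents of an irrational number -/

theorem not_terminatedAt_of_irrational {α : ℝ} (hα : Irrational α) (n : ℕ) :
    ¬ (GenContFract.of α).TerminatedAt n := fun h => by
  obtain ⟨r, hr⟩ := (GenContFract.terminates_iff_rat α).mp ⟨n, h⟩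
  exact hα ⟨r, hr.symm⟩

theorem contsAux_succ_succ_of_irrational {α : ℝ} (hα : Irrational α) (n : ℕ) :
    (∃ z : ℤ, partialQuotient α (n + 1) = z) ∧
    ((GenContFract.of α).contsAux (n + 2)).a =
      partialQuotient α (n + 1) * ((GenContFract.of α).contsAux (n + 1)).a +
        ((GenContFract.of α).contsAux n).a ∧
    ((GenContFract.of α).contsAux (n + 2)).b =
      partialQuotient α (n + 1) * ((GenContFract.of α).contsAux (n + 1)).b +
        ((GenContFract.of α).contsAux n).b := by
  obtain ⟨gp, hgp⟩ := Option.ne_none_iff_exists'.mp (not_terminatedAt_of_irrational hα n)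
  obtain ⟨ha, z, hz⟩ := GenContFract.of_partNum_eq_one_and_exists_int_partDen_eq hgp
  have hpq : partialQuotient α (n + 1) = gp.b := by
    simp [partialQuotient, GenContFract.partDen_eq_s_b hgp]
  rw [hpq, GenContFract.contsAux_recurrence hgp rfl rfl, ha]
  exact ⟨⟨z, hz⟩, by simp, by simp⟩

/-- The determinant `±1` of consecutive convergents supplies the Bézout coefficients for
coprimality. The index of `contsAux` is shifted by one: index `0` is the formal convergent `1 / 0`.
-/
theorem exists_int_contsAux {α : ℝ} (hα : Irrational α) (n : ℕ) :
    ∃ p q p' q' : ℤ,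
      ((GenContFract.of α).contsAux n).a = p ∧ ((GenContFract.of α).contsAux n).b = q ∧
      ((GenContFract.of α).contsAux (n + 1)).a = p' ∧
      ((GenContFract.of α).contsAux (n + 1)).b = q' ∧
      (p' * q - p * q' = 1 ∨ p' * q - p * q' = -1) := by
  induction n with
  | zero =>
    exact ⟨1, 0, ⌊α⌋, 1, by simp [GenContFract.contsAux], by simp [GenContFract.contsAux],
      by simp [GenContFract.contsAux, GenContFract.of_h_eq_floor],
      by simp [GenContFract.contsAux], by simp⟩
  | succ n ih =>
    obtain ⟨p, q, p', q', hp, hq, hp', hq', hdet⟩ := ih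
    obtain ⟨⟨z, hz⟩, ha, hb⟩ := contsAux_succ_succ_of_irrational hα n
    refine ⟨p', q', z * p' + p, z * q' + q, hp', hq', ?_, ?_, ?_⟩
    · rw [ha, hz, hp', hp]; push_cast; rfl
    · rw [hb, hz, hq', hq]; push_cast; rfl
    · rcases hdet with h | h
      · right; linarith
      · left; linarith

theorem one_le_dens_of (α : ℝ) (n : ℕ) : 1 ≤ (GenContFract.of α).dens n := by
  induction n with
  | zero => simp
  | succ n ih => exact ih.trans GenContFract.of_den_mono

theorem dens_succ_le {α : ℝ} (hα : Irrational α) (n : ℕ) :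
    (GenContFract.of α).dens (n + 1) ≤
      (partialQuotient α (n + 1) + 1) * (GenContFract.of α).dens n := by
  have h : ((GenContFract.of α).contsAux n).b ≤ (GenContFract.of α).dens n := by
    cases n with
    | zero => simp [GenContFract.contsAux]
    | succ n => exact GenContFract.of_den_mono
  have hb := (contsAux_succ_succ_of_irrational hα n).2.2
  change (GenContFract.of α).dens (n + 1) = _ * (GenContFract.of α).dens n + _ at hb
  linarith

/-- The convergents of an irrational number, as fractions in lowest terms. -/
theorem exists_coprime_convergent {α : ℝ} (hα : Irrational α) (n : ℕ) :
    ∃ (p : ℤ) (q : ℕ), 0 < q ∧ IsCoprime p (q : ℤ) ∧ |q * α - p| ≤ 1 / q ∧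
      (q : ℝ) = (GenContFract.of α).dens n := by
  obtain ⟨p₀, q₀, p, q, -, -, hp, hq, hdet⟩ := exists_int_contsAux hα n
  change (GenContFract.of α).nums n = p at hp
  change (GenContFract.of α).dens n = q at hq
  have h1 := one_le_dens_of α n
  have hqpos : 0 < q := by
    rw [hq] at h1
    exact_mod_cast lt_of_lt_of_le one_pos h1
  lift q to ℕ using hqpos.le
  push_cast at hq
  refine ⟨p, q, by exact_mod_cast hqpos, ?_, ?_, hq.symm⟩
  · rcases hdet with h | h
    · exact ⟨q₀, -p₀, by linarith⟩
    · exact ⟨-q₀, p₀, by linarith⟩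
  · have happ := GenContFract.abs_sub_convs_le (not_terminatedAt_of_irrational hα n)
    have hmono : (GenContFract.of α).dens n ≤ (GenContFract.of α).dens (n + 1) :=
      GenContFract.of_den_mono
    rw [GenContFract.conv_eq_num_div_den, hp] at happ
    rw [hq] at happ hmono h1
    have hq' : (0 : ℝ) < q := lt_of_lt_of_le one_pos h1
    have h2 : (q : ℝ) * α - p = q * (α - p / q) := by field_simp
    rw [h2, abs_mul, abs_of_pos hq']
    calc (q : ℝ) * |α - p / q| ≤ q * (1 / (q * (GenContFract.of α).dens (n + 1))) := by gcongr
      _ = 1 / (GenContFract.of α).dens (n + 1) := by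
        have : (GenContFract.of α).dens (n + 1) ≠ 0 := by linarith
        field_simp
      _ ≤ 1 / q := by gcongr

/-! ### Logarithmic discrepancy of the orbit -/

/-- Ostrowski induction: divide `N` by the denominator `q` of index `m`. The quotient is at most
`aₘ₊₁ + 1` and each of these blocks costs `3`; the remainder is below `q`. Here `c` must vary, as
the remainder starts at a shifted point. -/
theorem abs_rotationCount_sub_le_sum {α : ℝ} (hα : Irrational α) {x : ℝ} (hx0 : 0 ≤ x)
    (hx1 : x ≤ 1) (m N : ℕ) (c : ℝ) (hN : (N : ℝ) < (GenContFract.of α).dens m) :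
    |(rotationCount α c N x : ℝ) - N * x| ≤
      3 * ∑ i ∈ Icc 1 m, (partialQuotient α i + 1) := by
  induction m generalizing N c with
  | zero =>
    have : N = 0 := by simpa using hN
    subst this
    simp [rotationCount_zero]
  | succ m ih =>
    obtain ⟨p, q, hq, hpq, happ, hden⟩ := exists_coprime_convergent hα m
    have hq' : (0 : ℝ) < q := by exact_mod_cast hq
    have hb : ((N / q : ℕ) : ℝ) ≤ partialQuotient α (m + 1) + 1 := by
      refine le_of_mul_le_mul_right ?_ hq'
      calc ((N / q : ℕ) : ℝ) * q ≤ N := by exact_mod_cast Nat.div_mul_le_self N q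
        _ ≤ _ := hN.le
        _ ≤ _ := by rw [hden]; exact dens_succ_le hα m
    have hr := ih (N % q) (c + α * (N / q * q : ℕ))
      (by rw [← hden]; exact_mod_cast Nat.mod_lt N hq)
    have hblocks := abs_rotationCount_mul_sub_le
      (fun c => abs_rotationCount_sub_le c hq hpq happ hx0 hx1) (N / q) c
    have hsplit := abs_rotationCount_add_sub_le α c (N / q * q) (N % q) x
    rw [Nat.div_add_mod'] at hsplit
    rw [sum_Icc_succ_top (by omega)]
    linarith

theorem two_pow_le_fib (k : ℕ) : 2 ^ k ≤ Nat.fib (2 * k + 1) := by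
  induction k with
  | zero => simp
  | succ k ih =>
    have h1 : Nat.fib (2 * (k + 1) + 1) = Nat.fib (2 * k + 1) + Nat.fib (2 * k + 2) :=
      Nat.fib_add_two
    have h2 : Nat.fib (2 * k + 1) ≤ Nat.fib (2 * k + 2) := Nat.fib_le_fib_succ
    rw [pow_succ]
    omega

/-- The orbits of rotation by `α` have discrepancy `O(log n)` if the partial quotients of `α` are
bounded in average. -/
theorem exists_abs_rotationCount_sub_le_log {α : ℝ} (hα : Irrational α)
    (havg : PartialQuotientsBoundedInAverage α) :
    ∃ K : ℝ, ∀ n N : ℕ, 2 ≤ n → N ≤ n → ∀ c x : ℝ, 0 ≤ x → x ≤ 1 →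
      |(rotationCount α c N x : ℝ) - N * x| ≤ K * Real.log n := by
  obtain ⟨B, hB⟩ := havg
  have hlog2 : 0 < Real.log 2 := Real.log_pos one_lt_two
  refine ⟨12 * (|B| + 1) / Real.log 2, fun n N hn hNn c x hx0 hx1 => ?_⟩
  -- With this `k`, `n < 2 ^ k ≤ fib (2k + 1)`, which is at most the denominator of index `2k`.
  set k := Nat.log 2 n + 1 with hk
  have hlt : n < 2 ^ k := Nat.lt_pow_succ_log_self one_lt_two n
  have hfib : (Nat.fib (2 * k + 1) : ℝ) ≤ (GenContFract.of α).dens (2 * k) :=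
    GenContFract.succ_nth_fib_le_of_nth_den (Or.inr (not_terminatedAt_of_irrational hα _))
  have hden : (N : ℝ) < (GenContFract.of α).dens (2 * k) := by
    refine lt_of_lt_of_le ?_ hfib
    exact_mod_cast hNn.trans_lt (hlt.trans_le (two_pow_le_fib k))
  refine (abs_rotationCount_sub_le_sum hα hx0 hx1 (2 * k) N c hden).trans ?_
  have hsum := hB (2 * k) (by omega)
  have hkpos : (0 : ℝ) < (2 * k : ℕ) := by exact_mod_cast (by omega : 0 < 2 * k)
  rw [div_le_iff₀ hkpos] at hsum
  have hkn : (k : ℝ) ≤ 2 * (Real.log n / Real.log 2) := by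
    have hn0 : n ≠ 0 := by omega
    have h1 : 2 ^ Nat.log 2 n ≤ n := Nat.pow_log_le_self 2 hn0
    have h2 : (Nat.log 2 n : ℝ) * Real.log 2 ≤ Real.log n := by
      rw [← Real.log_pow]
      exact Real.log_le_log (by positivity) (by exact_mod_cast h1)
    have h3 : Real.log 2 ≤ Real.log n := Real.log_le_log two_pos (by exact_mod_cast hn)
    rw [← mul_div_assoc, le_div_iff₀ hlog2, hk]
    push_cast
    linarith
  rw [sum_add_distrib, sum_const, Nat.card_Icc, nsmul_eq_mul]
  have hle : B * (2 * k : ℕ) ≤ |B| * (2 * k : ℕ) := by gcongr; exact le_abs_self B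
  calc 3 * (∑ i ∈ Icc 1 (2 * k), partialQuotient α i + ((2 * k + 1 - 1 : ℕ) : ℝ) * 1)
      ≤ 6 * (|B| + 1) * k := by
        rw [Nat.add_sub_cancel]
        push_cast at hsum hle ⊢
        linarith
    _ ≤ 6 * (|B| + 1) * (2 * (Real.log n / Real.log 2)) := by gcongr
    _ = _ := by ring

/-! ### From cyclic intervals to initial segments -/

/-- On representatives in `{1, …, n}`, the indicator of a cyclic interval is a combination of a
constant and the indicators of two initial segments. -/
theorem IsCyclicInterval.exists_indicator_eq {n : ℕ} [NeZero n] {I : Finset (ZMod n)}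
    (hI : IsCyclicInterval I) : ∃ (c : ℝ) (u v : ℕ), u ≤ n ∧ v ≤ n ∧
      ∀ t : Icc 1 n, (if residueEquiv n t ∈ I then 1 else 0 : ℝ) =
        c + (if (t : ℕ) ≤ v then 1 else 0) - (if (t : ℕ) ≤ u then 1 else 0) := by
  obtain ⟨a, b, hab⟩ := hI
  have hn : (0 : ℤ) < n := by exact_mod_cast Nat.pos_of_ne_zero (NeZero.ne n)
  -- Membership is decided by the cyclic distance from `a` to `t`. The remainder of `a - 1` marks
  -- the place just before the interval starts.
  have hmem : ∀ t : Icc 1 n,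
      residueEquiv n t ∈ I ↔ (((t : ℕ) : ℤ) - (a - 1) % n - 1) % n ≤ b - a := by
    intro t
    have hmod : (((t : ℕ) : ℤ) - (a - 1) % n - 1) % n = ((t : ℕ) - a) % n := by
      rw [Int.sub_sub, Int.sub_emod, Int.add_emod, Int.emod_emod, ← Int.add_emod,
        ← Int.sub_emod]
      congr 1
      ring
    rw [hmod, ← mem_coe, hab]
    change ((t : ℕ) : ZMod n) ∈ _ ↔ _
    constructor
    · rintro ⟨z, hz, hzt⟩
      rw [Set.mem_Icc] at hz
      have h1 : (z : ℤ) ≡ (t : ℕ) [ZMOD n] := by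
        rw [← ZMod.intCast_eq_intCast_iff]
        simpa using hzt
      have h2 : (((t : ℕ) : ℤ) - a) % n = (z - a) % n := ((h1.sub_right a).symm :)
      rw [h2]
      have h3 : (z - a) % n ≤ z - a := by
        have h4 := Int.emod_add_mul_ediv (z - a) n
        have h5 := mul_nonneg hn.le (Int.ediv_nonneg (by omega : 0 ≤ z - a) hn.le)
        omega
      omega
    · intro h
      refine ⟨a + (((t : ℕ) : ℤ) - a) % n, ?_, ?_⟩
      · have := Int.emod_nonneg (((t : ℕ) : ℤ) - a) hn.ne'
        rw [Set.mem_Icc]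
        omega
      · simp
  have hr0 := Int.emod_nonneg (a - 1) hn.ne'
  have hrn := Int.emod_lt_of_pos (a - 1) hn
  set r := (a - 1) % (n : ℤ)
  have hval : ∀ t : Icc 1 n, (((t : ℕ) : ℤ) - r - 1) % n =
      if ((t : ℕ) : ℤ) ≤ r then ((t : ℕ) : ℤ) - r - 1 + n else ((t : ℕ) : ℤ) - r - 1 := by
    intro t
    have ht := mem_Icc.mp t.2
    split_ifs with h
    · rw [← Int.add_emod_right, Int.emod_eq_of_lt (by omega) (by omega)]
    · rw [Int.emod_eq_of_lt (by omega) (by omega)]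
  simp only [hmem, hval]
  by_cases h1 : b < a
  · refine ⟨0, 0, 0, by omega, by omega, fun t => ?_⟩
    have ht := mem_Icc.mp t.2
    rw [if_neg (by split_ifs <;> omega)]
    ring
  by_cases h2 : n ≤ b - a + 1
  · refine ⟨1, 0, 0, by omega, by omega, fun t => ?_⟩
    have ht := mem_Icc.mp t.2
    rw [if_pos (by split_ifs <;> omega)]
    ring
  by_cases h3 : r + (b - a) + 1 ≤ n
  · refine ⟨0, r.toNat, (r + (b - a) + 1).toNat, by omega, by omega, fun t => ?_⟩
    have ht := mem_Icc.mp t.2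
    split_ifs <;> first | omega | norm_num
  -- The interval wraps around: it is the complement of the gap between `v` and `u`.
  · refine ⟨1, r.toNat, (r + (b - a) + 1 - n).toNat, by omega, by omega, fun t => ?_⟩
    have ht := mem_Icc.mp t.2
    split_ifs <;> first | omega | norm_num

theorem sum_Icc_coe_ite_le {n v : ℕ} (hv : v ≤ n) :
    ∑ t : Icc 1 n, (if (t : ℕ) ≤ v then 1 else 0 : ℝ) = v := by
  rw [sum_coe_sort (Icc 1 n) (fun t => if t ≤ v then (1 : ℝ) else 0), ← sum_filter]
  have : (Icc 1 n).filter (· ≤ v) = Icc 1 v := by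
    ext t
    simp only [mem_filter, mem_Icc]
    omega
  simp [this]

/-- If a permutation has small discrepancy on pairs of initial segments of `{1, …, n}`, then it has
small discrepancy on pairs of cyclic intervals. -/
theorem permDiscrepancy_permCongr_le {n : ℕ} [NeZero n] (π : Equiv.Perm (Icc 1 n)) {K : ℝ}
    (hK : ∀ A B : ℕ, A ≤ n → B ≤ n →
      |∑ t : Icc 1 n, (if (t : ℕ) ≤ A then 1 else 0 : ℝ) * (if (π t : ℕ) ≤ B then 1 else 0) -
        A * B / n| ≤ K) :
    permDiscrepancy ((residueEquiv n).permCongr π) ≤ 4 * K := by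
  obtain ⟨I, J, hI, hJ, h⟩ := (isGreatest_permDiscrepancy ((residueEquiv n).permCongr π)).1
  rw [h, setDiscrepancy]
  have hn : (n : ℝ) ≠ 0 := NeZero.ne _
  have hcard : ∀ S : Finset (ZMod n),
      (#S : ℝ) = ∑ t : Icc 1 n, if residueEquiv n t ∈ S then (1 : ℝ) else 0 := by
    intro S
    rw [(residueEquiv n).sum_comp (fun z => if z ∈ S then (1 : ℝ) else 0)]
    simp
  have hmap : ∀ t : Icc 1 n, residueEquiv n (π t) ∈
      I.map ((residueEquiv n).permCongr π).toEmbedding ↔ residueEquiv n t ∈ I := by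
    intro t
    rw [mem_map_equiv]
    simp [Equiv.permCongr_def]
  have hcardinter : (#(I.map ((residueEquiv n).permCongr π).toEmbedding ∩ J) : ℝ) =
      ∑ t : Icc 1 n, (if residueEquiv n t ∈ I then 1 else 0 : ℝ) *
        (if residueEquiv n (π t) ∈ J then 1 else 0) := by
    rw [hcard, ← Equiv.sum_comp π]
    refine sum_congr rfl fun t _ => ?_
    simp only [mem_inter, hmap]
    split_ifs <;> first | tauto | norm_num
  obtain ⟨c, u, v, hu, hv, hi⟩ := hI.exists_indicator_eq
  obtain ⟨c', u', v', hu', hv', hj⟩ := hJ.exists_indicator_eq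
  set G : ℕ → ℕ → ℝ := fun A B =>
    ∑ t : Icc 1 n, (if (t : ℕ) ≤ A then 1 else 0 : ℝ) * (if (π t : ℕ) ≤ B then 1 else 0)
  have hπ : ∀ B ≤ n, ∑ t : Icc 1 n, (if (π t : ℕ) ≤ B then 1 else 0 : ℝ) = B := fun B hB => by
    rw [Equiv.sum_comp π (fun t => if (t : ℕ) ≤ B then (1 : ℝ) else 0), sum_Icc_coe_ite_le hB]
  have hconst : ∑ t : Icc 1 n, (1 : ℝ) = n := by simp
  have hcI : (#I : ℝ) = c * n + v - u := by
    rw [hcard]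
    simp only [hi, sum_add_distrib, sum_sub_distrib, sum_Icc_coe_ite_le hu, sum_Icc_coe_ite_le hv]
    simp [mul_comm]
  have hcJ : (#J : ℝ) = c' * n + v' - u' := by
    rw [hcard]
    simp only [hj, sum_add_distrib, sum_sub_distrib, sum_Icc_coe_ite_le hu', sum_Icc_coe_ite_le hv']
    simp [mul_comm]
  have hinter : ∑ t : Icc 1 n, (if residueEquiv n t ∈ I then 1 else 0 : ℝ) *
        (if residueEquiv n (π t) ∈ J then 1 else 0) =
      c * c' * n + c * (v' - u') + c' * (v - u) + (G v v' - G v u' - G u v' + G u u') := by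
    rw [← hconst]
    conv_rhs => rw [← hπ v' hv', ← hπ u' hu', ← sum_Icc_coe_ite_le hv, ← sum_Icc_coe_ite_le hu]
    simp only [G, mul_sum, ← sum_sub_distrib, ← sum_add_distrib]
    refine sum_congr rfl fun t _ => ?_
    rw [hi, hj]
    ring
  rw [card_map, hcardinter, hinter, hcI, hcJ]
  have e1 := abs_le.mp (hK v v' hv hv')
  have e2 := abs_le.mp (hK v u' hv hu')
  have e3 := abs_le.mp (hK u v' hu hv')
  have e4 := abs_le.mp (hK u u' hu hu')
  -- The constants cancel because a permutation has exact marginals; four corner errors remain,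
  -- whence the factor `4`.
  have hid : c * c' * n + c * (v' - u') + c' * (v - u) + (G v v' - G v u' - G u v' + G u u') -
      (c * n + v - u) * (c' * n + v' - u') / n =
      (G v v' - v * v' / n) - (G v u' - v * u' / n) - (G u v' - u * v' / n) +
        (G u u' - u * u' / n) := by
    field_simp
    ring
  rw [hid, abs_le]
  constructor <;> linarith

/-! ### The Sós permutation -/

theorem sum_ite_le_mul_ite_fract_le {α x : ℝ} {n A : ℕ} (hA : A ≤ n) :
    ∑ t : Icc 1 n, (if (t : ℕ) ≤ A then 1 else 0 : ℝ) *
      (if Int.fract (α * (t : ℕ)) ≤ x then 1 else 0) = rotationCount α α A x := by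
  rw [sum_coe_sort (Icc 1 n)
    (fun t => (if t ≤ A then (1 : ℝ) else 0) * (if Int.fract (α * (t : ℕ)) ≤ x then 1 else 0))]
  simp only [ite_mul, one_mul, zero_mul]
  rw [← sum_filter]
  have : (Icc 1 n).filter (· ≤ A) = Ico (0 + 1) (A + 1) := by
    ext t
    simp only [mem_filter, mem_Icc, mem_Ico]
    omega
  rw [this, ← sum_Ico_add', ← range_eq_Ico, rotationCount, card_filter]
  push_cast
  refine sum_congr rfl fun j _ => ?_
  rw [mul_add, mul_one, add_comm]

/-- Take for `x` the `B`-th smallest of the `{α t}`. One use of `hK` compares the count up to `A`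
with `A x`; another, at `N = n` where the count is exactly `B`, compares `n x` with `B`. For `B = 0`
there is no such point. -/
theorem sosPerm_discrepancy_initial_le {α : ℝ} (hα : Irrational α) {n : ℕ} {K : ℝ}
    (hK : ∀ N ≤ n, ∀ x : ℝ, 0 ≤ x → x ≤ 1 → |(rotationCount α α N x : ℝ) - N * x| ≤ K)
    {A B : ℕ} (hA : A ≤ n) (hB : B ≤ n) :
    |∑ t : Icc 1 n, (if (t : ℕ) ≤ A then 1 else 0 : ℝ) *
      (if (sosPerm α hα n t : ℕ) ≤ B then 1 else 0) - A * B / n| ≤ 2 * K := by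
  have hK0 : 0 ≤ K := (abs_nonneg _).trans (hK 0 (Nat.zero_le n) 0 le_rfl zero_le_one)
  rcases Nat.eq_zero_or_pos B with rfl | hBpos
  · have : ∀ t : Icc 1 n, ¬ (sosPerm α hα n t : ℕ) ≤ 0 := fun t => by
      have := mem_Icc.mp (sosPerm α hα n t).2
      omega
    simp only [this]
    simpa using hK0
  · obtain ⟨t₀, ht₀⟩ := (sosPerm α hα n).surjective ⟨B, mem_Icc.mpr ⟨hBpos, hB⟩⟩
    set x := Int.fract (α * (t₀ : ℕ))
    have hx0 : 0 ≤ x := Int.fract_nonneg _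
    have hx1 : x ≤ 1 := (Int.fract_lt_one _).le
    have hiff : ∀ t : Icc 1 n, (sosPerm α hα n t : ℕ) ≤ B ↔ Int.fract (α * (t : ℕ)) ≤ x := by
      intro t
      have h := (sosPerm_lt_iff α hα n t₀ t).not
      rw [not_lt, not_lt, ht₀] at h
      exact h
    have hBcount : (rotationCount α α n x : ℝ) = B := by
      rw [← sum_ite_le_mul_ite_fract_le le_rfl]
      simp only [← hiff]
      rw [← sum_Icc_coe_ite_le hB,
        ← Equiv.sum_comp (sosPerm α hα n) (fun t => if (t : ℕ) ≤ B then (1 : ℝ) else 0)]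
      refine sum_congr rfl fun t _ => ?_
      rw [if_pos (mem_Icc.mp t.2).2, one_mul]
    simp only [hiff]
    rw [sum_ite_le_mul_ite_fract_le hA]
    have h1 := hK A hA x hx0 hx1
    have h2 := hK n le_rfl x hx0 hx1
    rw [hBcount] at h2
    have hn : (0 : ℝ) < n := by exact_mod_cast hBpos.trans_le hB
    have hAn : (A : ℝ) / n ≤ 1 := (div_le_one hn).mpr (by exact_mod_cast hA)
    have h3 : |(A : ℝ) / n * (B - n * x)| ≤ K := by
      rw [abs_mul, abs_of_nonneg (by positivity)]
      exact (mul_le_of_le_one_left (abs_nonneg _) hAn).trans h2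
    have hid : (rotationCount α α A x : ℝ) - A * B / n =
        (rotationCount α α A x - A * x) - A / n * (B - n * x) := by
      field_simp
      ring
    rw [hid]
    refine (abs_sub _ _).trans ?_
    linarith

theorem mainTheorem7 (α : ℝ) (hα : Irrational α)
    (havg : PartialQuotientsBoundedInAverage α) :
    ∃ C : ℝ, ∃ N : ℕ, ∀ (n : ℕ) [NeZero n], N ≤ n →
      permDiscrepancy (sosPermZMod α hα n) ≤ C * Real.log n := by
  obtain ⟨K, hK⟩ := exists_abs_rotationCount_sub_le_log hα havg
  refine ⟨8 * K, 2, fun n _ hn => ?_⟩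
  have h := permDiscrepancy_permCongr_le (sosPerm α hα n) (K := 2 * (K * Real.log n))
    fun A B hA hB => sosPerm_discrepancy_initial_le hα
      (fun N hN x hx0 hx1 => hK n N hn hN α x hx0 hx1) hA hB
  calc permDiscrepancy (sosPermZMod α hα n) ≤ 4 * (2 * (K * Real.log n)) := h
    _ = 8 * K * Real.log n := by ring
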